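/- Let $m,K\ge 0$ be integers and $T>0$. Let $H:[0,T]\to\mathbb C^{m\times m}$ be Hermitian-valued and $\gamma_1,\dots,\gamma_K:[0,T]\to[0,\infty)$, with $H$ and all $\gamma_k$ twice continuously differentiable, and let $L_1,\dots,L_K\in\mathbb C^{m\times m}$. Let $\rho:[0,T]\to\mathbb C^{m\times m}$ be a solution of the Lindblad equation $$\dot\rho(t)=-i[H(t),\rho(t)]+\sum_{k=1}^K\gamma_k(t)\Big(L_k\rho(t)L_k^\dagger-\tfrac12\{L_k^\dagger L_k,\rho(t)\}\Big)$$ whose initial value $\rho(0)$ is Hermitian and positive semidefinite with unit trace. Put $A(t)=-iH(t)-\frac12\sum_k\gamma_k(t)L_k^\dagger L_k$. For a step size $\tau$, a time $t$ and a matrix $X$, let $$Y=e^{\frac\tau2A(t)}\Big(X+\tfrac\tau2\sum_k\gamma_k(t)L_kXL_k^\dagger\Big)e^{\frac\tau2A(t)^\dagger},\qquad s=t+\tfrac\tau2,$$ $$\Phi_\tau(t,X)=e^{\tau A(s)}Xe^{\tau A(s)^\dagger}+\tau\sum_k\gamma_k(s)\,e^{\frac\tau2A(s)}L_kYL_k^\dagger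 e^{\frac\tau2A(s)^\dagger}.$$ For an integer $N\ge1$ let $\tau=T/N$, $t_n=n\tau$. The unnormalized full-rank exponential midpoint scheme is $\rho_{n+1}=\Phi_\tau(t_n,\rho_n)$ with $\rho_0=\rho(0)$. Let $\|X\|_1=\operatorname{Tr}\sqrt{X^\dagger X}$ be the trace norm and $$C_2=\sum_{k=1}^K\Big(\max_{0\le t\le T}\gamma_k(t)\Big)\|L_k\|_1^2 .$$ Theorem. Some $M$ bounds, in modulus on $[0,T]$, the entries of all $L_k$ and the values and first and second derivatives of all $\gamma_k$ and of all entries of $A$ and $\rho$. For every such $M$ there is a constant $C_1>0$, depending only on $m$, $K$ and $M$, such that for all $N\ge1$ $$\|\rho(t_{n+1})-\Phi_\tau(t_n,\rho(t_n))\|_1\le C_1\tau^3\quad(0\le n<N),\qquad \|\rho(t_n)-\rho_n\|_1\le C_3\tau^2\quad(0\le n\le N),$$ where $C_3=\frac{C_1}{C_2}\left(e^{C_2T}-1\right)>0$, to be read as its limiting value $C_1T$ if $C_2=0$. -/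

import Mathlib

open Set
open scoped Matrix ComplexOrder

noncomputable section

namespace FREM

/-- The trace norm `‖X‖₁ = Tr √(X† X)`: the sum of the singular values of `X`, that is, of the
square roots of the eigenvalues (with multiplicity) of the Hermitian matrix `X† X`. -/
def traceNorm {m : ℕ} (X : Matrix (Fin m) (Fin m) ℂ) : ℝ :=
  ∑ i, Real.sqrt ((Matrix.isHermitian_conjTranspose_mul_self X).eigenvalues i)

/-- Density matrices: Hermitian, positive semidefinite, of unit trace. -/
def IsDensityMatrix {m : ℕ} (X : Matrix (Fin m) (Fin m) ℂ) : Prop :=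
  X.PosSemidef ∧ X.trace = 1

/-- The data of a Lindblad equation with `K` channels on `m × m` matrices: the (time dependent)
Hamiltonian `H`, the decay parameters `γ k` and the jump operators `L k`. -/
structure LindbladData (m K : ℕ) where
  H : ℝ → Matrix (Fin m) (Fin m) ℂ
  γ : Fin K → ℝ → ℝ
  L : Fin K → Matrix (Fin m) (Fin m) ℂ

namespace LindbladData

variable {m K : ℕ} (S : LindbladData m K)

/-- On `[0, T]` the Hamiltonian is Hermitian, the decay parameters are nonnegative, and both are
twice continuously differentiable. -/
structure Admissible (T : ℝ) : Prop where
  hermitian : ∀ t ∈ Icc 0 T, (S.H t).IsHermitian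
  nonneg : ∀ k, ∀ t ∈ Icc 0 T, 0 ≤ S.γ k t
  contDiffOn_H : ∀ a b, ContDiffOn ℝ 2 (fun t => S.H t a b) (Icc 0 T)
  contDiffOn_γ : ∀ k, ContDiffOn ℝ 2 (S.γ k) (Icc 0 T)

/-- The right-hand side of the Lindblad equation,
`-i [H(t), X] + ∑ k, γ_k(t) (L_k X L_k† - ½ {L_k† L_k, X})`. -/
def rhs (t : ℝ) (X : Matrix (Fin m) (Fin m) ℂ) : Matrix (Fin m) (Fin m) ℂ :=
  (-Complex.I) • (S.H t * X - X * S.H t) +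
    ∑ k, (S.γ k t : ℂ) • (S.L k * X * (S.L k)ᴴ -
      (1 / 2 : ℂ) • ((S.L k)ᴴ * S.L k * X + X * ((S.L k)ᴴ * S.L k)))

/-- `ρ` solves the Lindblad equation on `[0, T]` (one-sided derivatives at the end points). -/
def IsSolution (T : ℝ) (ρ : ℝ → Matrix (Fin m) (Fin m) ℂ) : Prop :=
  ∀ t ∈ Icc 0 T, ∀ a b,
    HasDerivWithinAt (fun s => ρ s a b) (S.rhs t (ρ t) a b) (Icc 0 T) t

/-- `A(t) = -i H(t) - ½ ∑ k, γ_k(t) L_k† L_k`. -/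
def A (t : ℝ) : Matrix (Fin m) (Fin m) ℂ :=
  (-Complex.I) • S.H t - (1 / 2 : ℂ) • ∑ k, (S.γ k t : ℂ) • ((S.L k)ᴴ * S.L k)

/-- `E h t = exp (h A(t))`. -/
def E (h t : ℝ) : Matrix (Fin m) (Fin m) ℂ := NormedSpace.exp ((h : ℂ) • S.A t)

/-- The intermediate value of the scheme at `t + τ / 2`, for a step of size `τ` from `X` at `t`:
`e^{(τ/2) A(t)} (X + (τ/2) ∑ k, γ_k(t) L_k X L_k†) e^{(τ/2) A(t)†}`. -/
def halfStep (τ t : ℝ) (X : Matrix (Fin m) (Fin m) ℂ) : Matrix (Fin m) (Fin m) ℂ :=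
  S.E (τ / 2) t *
    (X + ((τ / 2 : ℝ) : ℂ) • ∑ k, (S.γ k t : ℂ) • (S.L k * X * (S.L k)ᴴ)) *
    NormedSpace.exp (((τ / 2 : ℝ) : ℂ) • (S.A t)ᴴ)

/-- One step `Φ(t, X)` of size `τ` of the unnormalized full-rank exponential midpoint scheme:
with `s = t + τ / 2` and `Y` the intermediate value,
`e^{τ A(s)} X e^{τ A(s)†} + τ ∑ k, γ_k(s) e^{(τ/2) A(s)} L_k Y L_k† e^{(τ/2) A(s)†}`. -/
def step (τ t : ℝ) (X : Matrix (Fin m) (Fin m) ℂ) : Matrix (Fin m) (Fin m) ℂ :=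
  S.E τ (t + τ / 2) * X * NormedSpace.exp ((τ : ℂ) • (S.A (t + τ / 2))ᴴ) +
    (τ : ℂ) • ∑ k, (S.γ k (t + τ / 2) : ℂ) •
      (S.E (τ / 2) (t + τ / 2) * S.L k * S.halfStep τ t X * (S.L k)ᴴ *
        NormedSpace.exp (((τ / 2 : ℝ) : ℂ) • (S.A (t + τ / 2))ᴴ))

/-- The numerical solution `ρ_n`: `ρ_{n+1} = Φ(t_n, ρ_n)` with `t_n = n τ`, started from `ρ₀`. -/
def numSol (τ : ℝ) (ρ₀ : Matrix (Fin m) (Fin m) ℂ) : ℕ → Matrix (Fin m) (Fin m) ℂ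
  | 0 => ρ₀
  | n + 1 => S.step τ (n * τ) (numSol τ ρ₀ n)

/-- `M` bounds, on `[0, T]`, the entries of the `L_k`, and the values and first and second
derivatives of the `γ_k` and of the entries of `A` and `ρ`. -/
structure BoundedBy (T M : ℝ) (ρ : ℝ → Matrix (Fin m) (Fin m) ℂ) : Prop where
  bound_L : ∀ k a b, ‖S.L k a b‖ ≤ M
  bound_γ : ∀ k, ∀ j ≤ 2, ∀ t ∈ Icc 0 T,
    |iteratedDerivWithin j (S.γ k) (Icc 0 T) t| ≤ M
  bound_A : ∀ a b, ∀ j ≤ 2, ∀ t ∈ Icc 0 T,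
    ‖iteratedDerivWithin j (fun s => S.A s a b) (Icc 0 T) t‖ ≤ M
  bound_ρ : ∀ a b, ∀ j ≤ 2, ∀ t ∈ Icc 0 T,
    ‖iteratedDerivWithin j (fun s => ρ s a b) (Icc 0 T) t‖ ≤ M

/-- `C₂ = ∑ k, (max_{0 ≤ t ≤ T} γ_k(t)) ‖L_k‖₁²`. -/
def C₂ (T : ℝ) : ℝ := ∑ k, sSup (S.γ k '' Icc 0 T) * traceNorm (S.L k) ^ 2

end LindbladData

/-- `C₃ = (C₁ / C₂) (e^{C₂ T} - 1)`, read as its limit `C₁ T` if `C₂ = 0`. -/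
def C₃ (C₁ C₂ T : ℝ) : ℝ :=
  if C₂ = 0 then C₁ * T else C₁ / C₂ * (Real.exp (C₂ * T) - 1)

end FREM

end

/-
Write the Lindblad equation as `x' = 𝓐 x + 𝓙 x`, where `𝓐 X = A X + X A†` and `𝓙` is the gain term.
Since `A + A† ≤ 0`, the exponentials `e^{hA}` are contractions. This has two consequences.

Local error: the Taylor remainders of `e^{h𝓐} X = e^{hA} X e^{hA†}` are bounded with constants that
do not depend on the size of `h𝓐`, and one step of the scheme agrees with the midpoint rule for
`∫ x'` up to third order.

Stability: in the trace norm `e^{h𝓐}` is again a contraction and `𝓙` has norm at most `C₂`, so a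
step expands by at most `1 + C₂ τ + (C₂ τ)² / 2 ≤ e^{C₂ τ}`, and the local errors add up to a
geometric sum.
-/

noncomputable section

namespace FREM

open NormedSpace

section Exponential

variable {R : Type*} [NormedRing R] [NormedAlgebra ℝ R]

/-- `a` generates a contraction semigroup: `e^{ha}` has norm at most one for all `h ≥ 0`. -/
def GeneratesContractions (a : R) : Prop := ∀ h : ℝ, 0 ≤ h → ‖exp (h • a)‖ ≤ 1

/-- The Taylor polynomial `∑ j < n, (h a)^j / j!` of `e^{ha}`. -/
def expTaylor (n : ℕ) (a : R) (h : ℝ) : R := ∑ j ∈ Finset.range n, (h ^ j / j.factorial) • a ^ j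

lemma expTaylor_zero (n : ℕ) (a : R) : expTaylor (n + 1) a 0 = 1 := by
  simp [expTaylor, Finset.sum_range_succ']

lemma expTaylor_one (a : R) (h : ℝ) : expTaylor 1 a h = 1 := by
  simp [expTaylor]

lemma expTaylor_two (a : R) (h : ℝ) : expTaylor 2 a h = 1 + h • a := by
  simp [expTaylor, Finset.sum_range_succ]

lemma expTaylor_three (a : R) (h : ℝ) : expTaylor 3 a h = 1 + h • a + (h ^ 2 / 2) • a ^ 2 := by
  simp [expTaylor, Finset.sum_range_succ]

lemma hasDerivAt_expTaylor (n : ℕ) (a : R) (h : ℝ) :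
    HasDerivAt (expTaylor (n + 1) a) (a * expTaylor n a h) h := by
  induction n with
  | zero =>
    simpa only [funext (expTaylor_one a), expTaylor, Finset.range_zero, Finset.sum_empty,
      mul_zero] using hasDerivAt_const h (1 : R)
  | succ n ih =>
    have hterm : HasDerivAt (fun h : ℝ => (h ^ (n + 1) / (n + 1).factorial) • a ^ (n + 1))
        (a * ((h ^ n / n.factorial) • a ^ n)) h := by
      refine (((hasDerivAt_pow (n + 1) h).div_const ((n + 1).factorial : ℝ)).smul_const
        (a ^ (n + 1))).congr_deriv ?_
      rw [mul_smul_comm, ← pow_succ', Nat.factorial_succ, Nat.cast_mul, Nat.add_sub_cancel,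
        mul_div_mul_left _ _ (by positivity)]
    have hsucc : ∀ k, expTaylor (k + 1) a =
        fun h => expTaylor k a h + (h ^ k / k.factorial) • a ^ k :=
      fun k => funext fun h => Finset.sum_range_succ _ _
    rw [hsucc (n + 1)]
    exact (ih.fun_add hterm).congr_deriv (by rw [hsucc n, mul_add])

variable [CompleteSpace R]

lemma GeneratesContractions.norm_exp_sub_expTaylor_le {a : R} (ha : GeneratesContractions a)
    (n : ℕ) {h : ℝ} (hh : 0 ≤ h) :
    ‖exp (h • a) - expTaylor n a h‖ ≤ (h * ‖a‖) ^ n / n.factorial := by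
  induction n generalizing h with
  | zero => simpa [expTaylor] using ha h hh
  | succ n ih =>
    have hderiv : ∀ t : ℝ, HasDerivAt (fun t : ℝ => exp (t • a) - expTaylor (n + 1) a t)
        (a * (exp (t • a) - expTaylor n a t)) t := fun t =>
      ((hasDerivAt_exp_smul_const' (𝕂 := ℝ) a t).fun_sub (hasDerivAt_expTaylor n a t)).congr_deriv
        (mul_sub _ _ _).symm
    have hbound : ∀ t : ℝ, HasDerivAt (fun t : ℝ => (t * ‖a‖) ^ (n + 1) / (n + 1).factorial)
        (‖a‖ * ((t * ‖a‖) ^ n / n.factorial)) t := fun t => by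
      refine ((((hasDerivAt_id t).mul_const ‖a‖).pow (n + 1)).div_const
        ((n + 1).factorial : ℝ)).congr_deriv ?_
      simp only [Nat.factorial_succ, id_eq, Nat.add_sub_cancel, one_mul]
      push_cast
      field_simp
    refine image_norm_le_of_norm_deriv_right_le_deriv_boundary
      (fun t _ => (hderiv t).continuousAt.continuousWithinAt)
      (fun t _ => (hderiv t).hasDerivWithinAt) ?_ hbound
      (fun t ht => (norm_mul_le _ _).trans ?_) ⟨hh, le_rfl⟩
    · simp [expTaylor_zero]
    · gcongr
      exact ih ht.1

variable {S : Type*} [NormedRing S] [NormedAlgebra ℝ S]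

lemma exp_map (f : R →+* S) (hf : Continuous f) (a : R) : exp (f a) = f (exp a) := by
  let : NormedAlgebra ℚ R := NormedAlgebra.restrictScalars ℚ ℝ R
  let : NormedAlgebra ℚ S := NormedAlgebra.restrictScalars ℚ ℝ S
  exact (map_exp f hf a).symm

lemma exp_mulLeft (a x : R) : exp (ContinuousLinearMap.mul ℝ R a) x = exp a * x := by
  let f : R →+* (R →L[ℝ] R) :=
    { toFun := ContinuousLinearMap.mul ℝ R
      map_zero' := map_zero _
      map_add' := map_add _
      map_one' := by ext; simp
      map_mul' := fun a b => by ext; simp [mul_assoc] }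
  exact DFunLike.congr_fun (exp_map f (ContinuousLinearMap.mul ℝ R).continuous a) x

lemma exp_mulRight (a x : R) : exp ((ContinuousLinearMap.mul ℝ R).flip a) x = x * exp a := by
  let f : Rᵐᵒᵖ →+* (R →L[ℝ] R) :=
    { toFun := fun b => (ContinuousLinearMap.mul ℝ R).flip b.unop
      map_zero' := map_zero _
      map_add' := fun b c => map_add _ b.unop c.unop
      map_one' := by ext; simp
      map_mul' := fun a b => by ext; simp [mul_assoc] }
  have hf : Continuous f :=
    (ContinuousLinearMap.mul ℝ R).flip.continuous.comp MulOpposite.continuous_unop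
  have h := exp_map f hf (MulOpposite.op a)
  rw [exp_op] at h
  exact DFunLike.congr_fun h x

end Exponential

section Lyapunov

variable {R : Type*} [NormedRing R] [NormedAlgebra ℝ R] [StarRing R] [NormedStarGroup R]
  [StarModule ℝ R]

/-- The Lyapunov operator `x ↦ a x + x a*` as a (real) linear function of `a`. -/
def lyapunov : R →L[ℝ] R →L[ℝ] R :=
  ContinuousLinearMap.mul ℝ R +
    (ContinuousLinearMap.mul ℝ R).flip ∘L (starL' ℝ : R ≃L[ℝ] R).toContinuousLinearMap

lemma lyapunov_apply (a x : R) : lyapunov a x = a * x + x * star a := rfl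

lemma norm_lyapunov_le : ‖(lyapunov : R →L[ℝ] R →L[ℝ] R)‖ ≤ 2 := by
  refine ContinuousLinearMap.opNorm_le_bound _ zero_le_two fun a =>
    ContinuousLinearMap.opNorm_le_bound _ (by positivity) fun x => ?_
  calc ‖a * x + x * star a‖ ≤ ‖a‖ * ‖x‖ + ‖x‖ * ‖star a‖ :=
        norm_add_le_of_le (norm_mul_le _ _) (norm_mul_le _ _)
    _ = 2 * ‖a‖ * ‖x‖ := by rw [norm_star]; ring

variable [CompleteSpace R]

lemma exp_lyapunov_apply (a x : R) : exp (lyapunov a) x = exp a * x * star (exp a) := by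
  let : NormedAlgebra ℚ (R →L[ℝ] R) := NormedAlgebra.restrictScalars ℚ ℝ _
  have hcomm : Commute (ContinuousLinearMap.mul ℝ R a)
      ((ContinuousLinearMap.mul ℝ R).flip (star a)) := by
    ext y; simp [mul_assoc]
  calc exp (lyapunov a) x
      = exp (ContinuousLinearMap.mul ℝ R a)
          (exp ((ContinuousLinearMap.mul ℝ R).flip (star a)) x) :=
        DFunLike.congr_fun (exp_add_of_commute hcomm) x
    _ = exp a * x * star (exp a) := by rw [exp_mulRight, exp_mulLeft, star_exp, mul_assoc]

lemma GeneratesContractions.lyapunov {a : R} (ha : GeneratesContractions a) :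
    GeneratesContractions (lyapunov a) := fun h hh =>
  ContinuousLinearMap.opNorm_le_bound _ zero_le_one fun x => by
    rw [← map_smul, exp_lyapunov_apply]
    calc ‖exp (h • a) * x * star (exp (h • a))‖ ≤ ‖exp (h • a)‖ * ‖x‖ * ‖exp (h • a)‖ := by
          simpa only [norm_star] using norm_mul₃_le (a := exp (h • a)) (b := x)
            (c := star (exp (h • a)))
      _ ≤ 1 * ‖x‖ * 1 := by gcongr <;> exact ha h hh
      _ = 1 * ‖x‖ := mul_one _

end Lyapunov

section Dissipative

variable {H : Type*} [NormedAddCommGroup H] [InnerProductSpace ℂ H] [CompleteSpace H]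

/-- Dissipativity makes `‖e^{tA} v‖²` nonincreasing in `t`. -/
lemma generatesContractions_of_re_inner_nonpos {A : H →L[ℂ] H}
    (hA : ∀ v, (inner ℂ v (A v)).re ≤ 0) : GeneratesContractions A := fun h hh =>
  ContinuousLinearMap.opNorm_le_bound _ zero_le_one fun v => by
    let : InnerProductSpace ℝ H := InnerProductSpace.complexToReal
    have hderiv : ∀ t : ℝ, HasDerivAt (fun t : ℝ => exp (t • A) v) (A (exp (t • A) v)) t :=
      fun t => ((ContinuousLinearMap.apply ℂ H v).restrictScalars ℝ).hasFDerivAt.comp_hasDerivAt t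
        (hasDerivAt_exp_smul_const' (𝕂 := ℝ) A t)
    have hanti : Antitone fun t : ℝ => ‖exp (t • A) v‖ ^ 2 := by
      refine antitone_of_deriv_nonpos (fun t => (hderiv t).norm_sq.differentiableAt) fun t => ?_
      rw [(hderiv t).norm_sq.deriv]
      exact mul_nonpos_of_nonneg_of_nonpos zero_le_two (hA _)
    rw [one_mul, ← sq_le_sq₀ (norm_nonneg _) (norm_nonneg _)]
    simpa using hanti hh

end Dissipative

section Regularity

variable {E F : Type*} [NormedAddCommGroup E] [NormedSpace ℝ E] [NormedAddCommGroup F]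
  [NormedSpace ℝ F] {n : ℕ} {f g : ℝ → E} {s : Set ℝ} {C D : ℝ}

/-- `f` is `n` times continuously differentiable on `s`, and `C` bounds `f` and its derivatives
up to order `n` there. -/
structure ContDiffBoundOn (n : ℕ) (f : ℝ → E) (s : Set ℝ) (C : ℝ) : Prop where
  contDiffOn : ContDiffOn ℝ n f s
  norm_iteratedDerivWithin_le : ∀ j ≤ n, ∀ t ∈ s, ‖iteratedDerivWithin j f s t‖ ≤ C

namespace ContDiffBoundOn

lemma norm_le (hf : ContDiffBoundOn n f s C) {t : ℝ} (ht : t ∈ s) : ‖f t‖ ≤ C := by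
  simpa using hf.norm_iteratedDerivWithin_le 0 (Nat.zero_le n) t ht

lemma mono (hf : ContDiffBoundOn n f s C) (hCD : C ≤ D) : ContDiffBoundOn n f s D :=
  ⟨hf.contDiffOn, fun j hj t ht => (hf.norm_iteratedDerivWithin_le j hj t ht).trans hCD⟩

variable (hs : UniqueDiffOn ℝ s)
include hs

lemma add (hf : ContDiffBoundOn n f s C) (hg : ContDiffBoundOn n g s D) :
    ContDiffBoundOn n (fun t => f t + g t) s (C + D) where
  contDiffOn := hf.contDiffOn.add hg.contDiffOn
  norm_iteratedDerivWithin_le j hj t ht := by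
    have hj' : (j : WithTop ℕ∞) ≤ n := mod_cast hj
    rw [iteratedDerivWithin_fun_add ht hs ((hf.contDiffOn t ht).of_le hj')
      ((hg.contDiffOn t ht).of_le hj')]
    exact norm_add_le_of_le (hf.norm_iteratedDerivWithin_le j hj t ht)
      (hg.norm_iteratedDerivWithin_le j hj t ht)

lemma sum {ι : Type*} {I : Finset ι} {f : ι → ℝ → E} {C : ι → ℝ}
    (hf : ∀ i ∈ I, ContDiffBoundOn n (f i) s (C i)) :
    ContDiffBoundOn n (fun t => ∑ i ∈ I, f i t) s (∑ i ∈ I, C i) where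
  contDiffOn := ContDiffOn.sum fun i hi => (hf i hi).contDiffOn
  norm_iteratedDerivWithin_le j hj t ht := by
    have hj' : (j : WithTop ℕ∞) ≤ n := mod_cast hj
    rw [iteratedDerivWithin_fun_sum ht hs fun i hi => ((hf i hi).contDiffOn t ht).of_le hj']
    exact norm_sum_le_of_le I fun i hi => (hf i hi).norm_iteratedDerivWithin_le j hj t ht

lemma clm_comp (hf : ContDiffBoundOn n f s C) (L : E →L[ℝ] F) :
    ContDiffBoundOn n (fun t => L (f t)) s (‖L‖ * C) where
  contDiffOn := L.contDiff.comp_contDiffOn hf.contDiffOn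
  norm_iteratedDerivWithin_le j hj t ht := by
    have h := L.norm_iteratedFDerivWithin_comp_left (hf.contDiffOn t ht) hs ht (mod_cast hj)
    simp only [norm_iteratedFDerivWithin_eq_norm_iteratedDerivWithin] at h
    exact h.trans (by gcongr; exact hf.norm_iteratedDerivWithin_le j hj t ht)

lemma smul_const {f : ℝ → ℝ} (hf : ContDiffBoundOn n f s C) (v : E) :
    ContDiffBoundOn n (fun t => f t • v) s (‖v‖ * C) := by
  simpa using hf.clm_comp hs (ContinuousLinearMap.toSpanSingleton ℝ v)

lemma clm_apply {f : ℝ → E →L[ℝ] F} (hf : ContDiffBoundOn n f s C)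
    (hg : ContDiffBoundOn n g s D) :
    ContDiffBoundOn n (fun t => f t (g t)) s (2 ^ n * (C * D)) where
  contDiffOn := hf.contDiffOn.clm_apply hg.contDiffOn
  norm_iteratedDerivWithin_le j hj t ht := by
    have hC := (norm_nonneg _).trans (hf.norm_le ht)
    have hD := (norm_nonneg _).trans (hg.norm_le ht)
    have h := norm_iteratedFDerivWithin_clm_apply hf.contDiffOn hg.contDiffOn hs ht
      (mod_cast hj : (j : WithTop ℕ∞) ≤ n)
    simp only [norm_iteratedFDerivWithin_eq_norm_iteratedDerivWithin] at h
    calc _ ≤ _ := h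
      _ ≤ ∑ i ∈ Finset.range (j + 1), (j.choose i : ℝ) * C * D := by
        gcongr with i hi
        · exact hf.norm_iteratedDerivWithin_le i (by grind) t ht
        · exact hg.norm_iteratedDerivWithin_le (j - i) (by lia) t ht
      _ = 2 ^ j * (C * D) := by
        simp only [mul_assoc, ← Finset.sum_mul]
        rw [← Nat.cast_sum, Nat.sum_range_choose]
        push_cast
        rfl
      _ ≤ 2 ^ n * (C * D) := by gcongr; exact one_le_two

lemma derivWithin (hf : ContDiffBoundOn (n + 1) f s C) :
    ContDiffBoundOn n (derivWithin f s) s C where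
  contDiffOn := ((contDiffOn_succ_iff_derivWithin hs).1 (mod_cast hf.contDiffOn)).2.2
  norm_iteratedDerivWithin_le j hj t ht := by
    rw [← iteratedDerivWithin_succ']
    exact hf.norm_iteratedDerivWithin_le (j + 1) (by lia) t ht

lemma norm_sub_le (hconv : Convex ℝ s) (hf : ContDiffBoundOn (n + 1) f s C) {t u : ℝ}
    (ht : t ∈ s) (hu : u ∈ s) : ‖f u - f t‖ ≤ C * |u - t| :=
  hconv.norm_image_sub_le_of_norm_derivWithin_le (hf.contDiffOn.differentiableOn (by simp))
    (fun _ hv => (hf.derivWithin hs).norm_le hv) ht hu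

lemma norm_sub_sub_smul_derivWithin_le (hconv : Convex ℝ s) (hf : ContDiffBoundOn (n + 2) f s C)
    {t u : ℝ} (ht : t ∈ s) (hu : u ∈ s) :
    ‖f u - f t - (u - t) • _root_.derivWithin f s t‖ ≤ C * (u - t) ^ 2 := by
  have hC : 0 ≤ C := (norm_nonneg _).trans (hf.norm_le ht)
  have hsub : uIcc t u ⊆ s := hconv.ordConnected.uIcc_subset ht hu
  have hderiv : ∀ v ∈ uIcc t u, HasDerivWithinAt
      (fun v => f v - (v - t) • _root_.derivWithin f s t)
      (_root_.derivWithin f s v - _root_.derivWithin f s t) (uIcc t u) v := by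
    intro v hv
    have hlin := (((hasDerivAt_id v).sub_const t).smul_const
      (_root_.derivWithin f s t)).hasDerivWithinAt (s := uIcc t u)
    simpa using ((hf.contDiffOn.differentiableOn (by simp) v
      (hsub hv)).hasDerivWithinAt.mono hsub).fun_sub hlin
  have hlip : ∀ v ∈ uIcc t u,
      ‖_root_.derivWithin f s v - _root_.derivWithin f s t‖ ≤ C * |u - t| := fun v hv =>
    ((hf.derivWithin hs).norm_sub_le hs hconv ht (hsub hv)).trans
      (mul_le_mul_of_nonneg_left (abs_sub_left_of_mem_uIcc hv) hC)
  have h := (convex_uIcc t u).norm_image_sub_le_of_norm_hasDerivWithin_le hderiv hlip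
    left_mem_uIcc right_mem_uIcc
  rw [Real.norm_eq_abs, mul_assoc, ← sq, sq_abs] at h
  simpa [sub_right_comm] using h

end ContDiffBoundOn

lemma eventually_contDiffBoundOn (hcomp : IsCompact s) (hs : UniqueDiffOn ℝ s)
    (hf : ContDiffOn ℝ n f s) : ∀ᶠ C in Filter.atTop, ContDiffBoundOn n f s C := by
  have hbound : ∀ j ∈ Finset.range (n + 1), ∀ᶠ C in Filter.atTop,
      ∀ t ∈ s, ‖iteratedDerivWithin j f s t‖ ≤ C := by
    intro j hj
    have hj' : (j : WithTop ℕ∞) ≤ n := mod_cast Finset.mem_range_succ_iff.1 hj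
    obtain ⟨B, hB⟩ := hcomp.exists_bound_of_continuousOn
      (hf.continuousOn_iteratedDerivWithin hj' hs)
    filter_upwards [Filter.eventually_ge_atTop B] with C hC t ht
    exact (hB t ht).trans hC
  filter_upwards [(Filter.eventually_all_finset _).2 hbound] with C hC
  exact ⟨hf, fun j hj => hC j (Finset.mem_range_succ_iff.2 hj)⟩

/-- The midpoint rule: the error is of third order because the linear part of `v` about the
midpoint integrates to zero. -/
lemma norm_sub_sub_smul_midpoint_le {x v : ℝ → E} (hs : UniqueDiffOn ℝ s) (hconv : Convex ℝ s)
    (hv : ContDiffBoundOn (n + 2) v s D) (hx : ∀ t ∈ s, HasDerivWithinAt x (v t) s t) {t τ : ℝ}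
    (hτ : 0 ≤ τ) (ht : t ∈ s) (htτ : t + τ ∈ s) :
    ‖x (t + τ) - x t - τ • v (t + τ / 2)‖ ≤ D / 4 * τ ^ 3 := by
  set c := t + τ / 2 with hc
  have hsub : Icc t (t + τ) ⊆ s := hconv.ordConnected.out ht htτ
  have hcs : c ∈ s := hsub ⟨by linarith, by linarith⟩
  have hD : 0 ≤ D := (norm_nonneg _).trans (hv.norm_le ht)
  have hderiv : ∀ u ∈ Icc t (t + τ), HasDerivWithinAt
      (fun u => x u - (u - c) • v c - ((u - c) ^ 2 / 2) • derivWithin v s c)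
      (v u - v c - (u - c) • derivWithin v s c) (Icc t (t + τ)) u := by
    intro u hu
    have hlin := ((hasDerivAt_id u).sub_const c).smul_const (v c)
    have hquad := ((((hasDerivAt_id u).sub_const c).pow 2).div_const 2).smul_const
      (derivWithin v s c)
    refine ((((hx u (hsub hu)).mono hsub).fun_sub hlin.hasDerivWithinAt).fun_sub
      hquad.hasDerivWithinAt).congr_deriv ?_
    simp
  have hbound : ∀ u ∈ Icc t (t + τ),
      ‖v u - v c - (u - c) • derivWithin v s c‖ ≤ D * (τ / 2) ^ 2 := fun u hu =>
    (hv.norm_sub_sub_smul_derivWithin_le hs hconv hcs (hsub hu)).trans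
      (by gcongr 1; exact sq_le_sq' (by linarith [hu.1]) (by linarith [hu.2]))
  have h := (convex_Icc t (t + τ)).norm_image_sub_le_of_norm_hasDerivWithin_le hderiv hbound
    (left_mem_Icc.2 (by linarith)) (right_mem_Icc.2 (by linarith))
  calc _ = _ := by
        congr 1
        rw [hc]
        module
    _ ≤ _ := h
    _ = D / 4 * τ ^ 3 := by
        rw [add_sub_cancel_left, Real.norm_of_nonneg hτ]
        ring

lemma contDiffOn_succ_of_linear_ode {B : ℝ → E →L[ℝ] E} {x : ℝ → E} (hs : UniqueDiffOn ℝ s)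
    (hB : ContDiffOn ℝ n B s) (hx : ∀ t ∈ s, HasDerivWithinAt x (B t (x t)) s t) :
    ContDiffOn ℝ (n + 1) x s := by
  have hd : DifferentiableOn ℝ x s := fun t ht => (hx t ht).differentiableWithinAt
  induction n with
  | zero =>
    refine (contDiffOn_succ_iff_derivWithin hs).2 ⟨hd, by simp, ?_⟩
    exact (hB.clm_apply (by simpa using hd.continuousOn)).congr
      fun t ht => (hx t ht).derivWithin (hs t ht)
  | succ n ih =>
    refine (contDiffOn_succ_iff_derivWithin hs).2 ⟨hd, by simp, ?_⟩
    exact (hB.clm_apply (mod_cast ih (hB.of_le (by simp)))).congr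
      fun t ht => (hx t ht).derivWithin (hs t ht)

end Regularity

section ExponentialMidpoint

variable {E : Type*} [NormedAddCommGroup E] [NormedSpace ℝ E]

/-- The first stage of the exponential midpoint scheme for `x' = 𝓐 x + 𝓙 x`: an approximation of
the propagator from `t` to `t + τ / 2`. -/
def expMidpointHalf (𝓐 𝓙 : ℝ → E →L[ℝ] E) (τ t : ℝ) : E →L[ℝ] E :=
  exp ((τ / 2) • 𝓐 t) * (1 + (τ / 2) • 𝓙 t)

/-- The exponential midpoint scheme for `x' = 𝓐 x + 𝓙 x`: an approximation of the propagator from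
`t` to `t + τ`, obtained from the variation of constants formula by freezing `𝓐` and evaluating the
integrand at the midpoint. -/
def expMidpoint (𝓐 𝓙 : ℝ → E →L[ℝ] E) (τ t : ℝ) : E →L[ℝ] E :=
  exp (τ • 𝓐 (t + τ / 2)) +
    τ • (exp ((τ / 2) • 𝓐 (t + τ / 2)) * 𝓙 (t + τ / 2) * expMidpointHalf 𝓐 𝓙 τ t)

/-- All terms up to second order cancel once the midpoint rule is corrected by the expansion of
`x (t + τ / 2)` about `t`. -/
lemma sub_expMidpoint_eq (𝓐 𝓙 : ℝ → E →L[ℝ] E) (x : ℝ → E) (t τ : ℝ) :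
    x (t + τ) - expMidpoint 𝓐 𝓙 τ t (x t) =
      (x (t + τ) - x t -
        τ • (𝓐 (t + τ / 2) (x (t + τ / 2)) + 𝓙 (t + τ / 2) (x (t + τ / 2)))) +
      τ • 𝓐 (t + τ / 2) (x (t + τ / 2) - x t -
        (τ / 2) • (𝓐 (t + τ / 2) (x t) + 𝓙 (t + τ / 2) (x (t + τ / 2)))) -
      (exp (τ • 𝓐 (t + τ / 2)) (x t) - expTaylor 3 (𝓐 (t + τ / 2)) τ (x t)) -
      τ • (exp ((τ / 2) • 𝓐 (t + τ / 2)) (𝓙 (t + τ / 2) (expMidpointHalf 𝓐 𝓙 τ t (x t))) -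
        expTaylor 2 (𝓐 (t + τ / 2)) (τ / 2) (𝓙 (t + τ / 2) (x (t + τ / 2)))) := by
  simp only [expMidpoint, expTaylor_two, expTaylor_three, add_apply, one_apply_eq_self, smul_apply,
    mul_apply_eq_comp, map_sub, map_add, map_smul, sq]
  module

/-- `x` solves `x' = 𝓐 x + 𝓙 x` on `s`, where the `𝓐 t` generate contractions and `𝓐`, `𝓙`, `x` are
bounded in `C²` by `α`, `β`, `ξ`. -/
structure IsBoundedSolution (𝓐 𝓙 : ℝ → E →L[ℝ] E) (x : ℝ → E) (s : Set ℝ) (α β ξ : ℝ) :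
    Prop where
  uniqueDiffOn : UniqueDiffOn ℝ s
  convex : Convex ℝ s
  contraction : ∀ t ∈ s, GeneratesContractions (𝓐 t)
  bound_drift : ContDiffBoundOn 2 𝓐 s α
  bound_jump : ContDiffBoundOn 2 𝓙 s β
  bound_solution : ContDiffBoundOn 2 x s ξ
  hasDerivWithinAt : ∀ t ∈ s, HasDerivWithinAt x (𝓐 t (x t) + 𝓙 t (x t)) s t

lemma norm_smul_le_of_nonneg {c C : ℝ} (hc : 0 ≤ c) {v : E} (hv : ‖v‖ ≤ C) : ‖c • v‖ ≤ c * C :=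
  (norm_smul_of_nonneg hc v).trans_le (mul_le_mul_of_nonneg_left hv hc)

lemma GeneratesContractions.norm_exp_apply_le {a : E →L[ℝ] E} (ha : GeneratesContractions a)
    {h : ℝ} (hh : 0 ≤ h) (v : E) : ‖exp (h • a) v‖ ≤ ‖v‖ := by
  simpa using ContinuousLinearMap.le_of_opNorm_le _ (ha h hh) v

lemma GeneratesContractions.norm_exp_apply_sub_le [CompleteSpace E] {a : E →L[ℝ] E}
    (ha : GeneratesContractions a) {h α C : ℝ} (hh : 0 ≤ h) (hα : ‖a‖ ≤ α) {v : E}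
    (hv : ‖v‖ ≤ C) (n : ℕ) :
    ‖exp (h • a) v - expTaylor n a h v‖ ≤ (h * α) ^ n / n.factorial * C :=
  ContinuousLinearMap.le_of_opNorm_le_of_le (exp (h • a) - expTaylor n a h)
    ((ha.norm_exp_sub_expTaylor_le n hh).trans (by gcongr)) hv

namespace IsBoundedSolution

variable {𝓐 𝓙 : ℝ → E →L[ℝ] E} {x : ℝ → E} {s : Set ℝ} {α β ξ t τ : ℝ}
  (h : IsBoundedSolution 𝓐 𝓙 x s α β ξ)
include h

lemma norm_drift_apply_le (ht : t ∈ s) {v : E} {C : ℝ} (hv : ‖v‖ ≤ C) : ‖𝓐 t v‖ ≤ α * C :=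
  (𝓐 t).le_of_opNorm_le_of_le (h.bound_drift.norm_le ht) hv

lemma norm_jump_apply_le (ht : t ∈ s) {v : E} {C : ℝ} (hv : ‖v‖ ≤ C) : ‖𝓙 t v‖ ≤ β * C :=
  (𝓙 t).le_of_opNorm_le_of_le (h.bound_jump.norm_le ht) hv

lemma norm_sub_sub_smul_le (ht : t ∈ s) {u : ℝ} (hu : u ∈ s) :
    ‖x u - x t - (u - t) • (𝓐 t (x t) + 𝓙 t (x t))‖ ≤ ξ * (u - t) ^ 2 := by
  rw [← (h.hasDerivWithinAt t ht).derivWithin (h.uniqueDiffOn t ht)]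
  exact h.bound_solution.norm_sub_sub_smul_derivWithin_le h.uniqueDiffOn h.convex ht hu

lemma norm_midpoint_le (hτ : 0 ≤ τ) (ht : t ∈ s) (htτ : t + τ ∈ s) :
    ‖x (t + τ) - x t -
        τ • (𝓐 (t + τ / 2) (x (t + τ / 2)) + 𝓙 (t + τ / 2) (x (t + τ / 2)))‖ ≤
      (α + β) * ξ * τ ^ 3 := by
  have hU := h.uniqueDiffOn
  have hv := (h.bound_drift.clm_apply hU h.bound_solution).add hU
    (h.bound_jump.clm_apply hU h.bound_solution)
  refine (norm_sub_sub_smul_midpoint_le hU h.convex hv h.hasDerivWithinAt hτ ht htτ).trans_eq ?_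
  ring

lemma norm_half_step_le (hτ : 0 ≤ τ) (ht : t ∈ s) (hc : t + τ / 2 ∈ s) :
    ‖x (t + τ / 2) - x t - (τ / 2) • (𝓐 (t + τ / 2) (x t) + 𝓙 (t + τ / 2) (x (t + τ / 2)))‖ ≤
      (1 + α) / 4 * ξ * τ ^ 2 := by
  set c := t + τ / 2 with hc_def
  have htaylor := h.norm_sub_sub_smul_le hc ht
  have hlip : ‖x c - x t‖ ≤ ξ * (τ / 2) :=
    (h.bound_solution.norm_sub_le h.uniqueDiffOn h.convex ht hc).trans_eq (by
      rw [hc_def, add_sub_cancel_left, abs_of_nonneg (by positivity)])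
  calc _ = ‖(τ / 2) • 𝓐 c (x c - x t) - (x t - x c - (t - c) • (𝓐 c (x c) + 𝓙 c (x c)))‖ := by
        rw [hc_def, map_sub]
        congr 1
        module
    _ ≤ τ / 2 * (α * (ξ * (τ / 2))) + ξ * (t - c) ^ 2 := by
        exact norm_sub_le_of_le (norm_smul_le_of_nonneg (by positivity)
          (h.norm_drift_apply_le hc hlip)) htaylor
    _ = (1 + α) / 4 * ξ * τ ^ 2 := by rw [hc_def]; ring

variable [CompleteSpace E]

lemma norm_expMidpointHalf_sub_le (hτ : 0 ≤ τ) (ht : t ∈ s) (hc : t + τ / 2 ∈ s) :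
    ‖expMidpointHalf 𝓐 𝓙 τ t (x t) - x (t + τ / 2)‖ ≤
      (1 / 4 + α ^ 2 / 8 + α * β / 4) * ξ * τ ^ 2 := by
  have hτ' : 0 ≤ τ / 2 := by positivity
  have htaylor := h.norm_sub_sub_smul_le ht hc
  have hX := h.bound_solution.norm_le ht
  have hflow := (h.contraction t ht).norm_exp_apply_sub_le hτ' (h.bound_drift.norm_le ht) hX 2
  have hgain := (h.contraction t ht).norm_exp_apply_sub_le hτ' (h.bound_drift.norm_le ht)
    (h.norm_jump_apply_le ht hX) 1
  set e := exp ((τ / 2) • 𝓐 t)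
  calc ‖expMidpointHalf 𝓐 𝓙 τ t (x t) - x (t + τ / 2)‖
      = ‖(e (x t) - expTaylor 2 (𝓐 t) (τ / 2) (x t)) +
          (τ / 2) • (e (𝓙 t (x t)) - expTaylor 1 (𝓐 t) (τ / 2) (𝓙 t (x t))) -
          (x (t + τ / 2) - x t - (t + τ / 2 - t) • (𝓐 t (x t) + 𝓙 t (x t)))‖ := by
        have hval : expMidpointHalf 𝓐 𝓙 τ t (x t) = e (x t) + (τ / 2) • e (𝓙 t (x t)) := by
          simp [expMidpointHalf, e]
        rw [hval, expTaylor_one, expTaylor_two]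
        simp only [add_apply, one_apply_eq_self, smul_apply]
        congr 1
        module
    _ ≤ (τ / 2 * α) ^ 2 / (2).factorial * ξ +
          τ / 2 * ((τ / 2 * α) ^ 1 / (1).factorial * (β * ξ)) + ξ * (t + τ / 2 - t) ^ 2 :=
        norm_sub_le_of_le (norm_add_le_of_le hflow (norm_smul_le_of_nonneg hτ' hgain)) htaylor
    _ = (1 / 4 + α ^ 2 / 8 + α * β / 4) * ξ * τ ^ 2 := by
        norm_num [Nat.factorial]
        ring

lemma norm_gain_sub_le (hτ : 0 ≤ τ) (ht : t ∈ s) (hc : t + τ / 2 ∈ s) :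
    ‖exp ((τ / 2) • 𝓐 (t + τ / 2)) (𝓙 (t + τ / 2) (expMidpointHalf 𝓐 𝓙 τ t (x t))) -
        expTaylor 2 (𝓐 (t + τ / 2)) (τ / 2) (𝓙 (t + τ / 2) (x (t + τ / 2)))‖ ≤
      β * (1 / 4 + α ^ 2 / 4 + α * β / 4) * ξ * τ ^ 2 := by
  set c := t + τ / 2
  have hτ' : 0 ≤ τ / 2 := by positivity
  have hhalf := h.norm_expMidpointHalf_sub_le hτ ht hc
  have hgain := (h.contraction c hc).norm_exp_apply_sub_le hτ' (h.bound_drift.norm_le hc)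
    (h.norm_jump_apply_le hc (h.bound_solution.norm_le hc)) 2
  set e := exp ((τ / 2) • 𝓐 c)
  set Y := expMidpointHalf 𝓐 𝓙 τ t (x t)
  calc ‖e (𝓙 c Y) - expTaylor 2 (𝓐 c) (τ / 2) (𝓙 c (x c))‖
      = ‖e (𝓙 c (Y - x c)) +
          (e (𝓙 c (x c)) - expTaylor 2 (𝓐 c) (τ / 2) (𝓙 c (x c)))‖ := by
        simp only [map_sub]
        congr 1
        abel
    _ ≤ β * ((1 / 4 + α ^ 2 / 8 + α * β / 4) * ξ * τ ^ 2) +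
          (τ / 2 * α) ^ 2 / (2).factorial * (β * ξ) :=
        norm_add_le_of_le (((h.contraction c hc).norm_exp_apply_le hτ' _).trans
          (h.norm_jump_apply_le hc hhalf)) hgain
    _ = β * (1 / 4 + α ^ 2 / 4 + α * β / 4) * ξ * τ ^ 2 := by
        norm_num [Nat.factorial]
        ring

theorem norm_sub_expMidpoint_le (hτ : 0 ≤ τ) (ht : t ∈ s) (htτ : t + τ ∈ s) :
    ‖x (t + τ) - expMidpoint 𝓐 𝓙 τ t (x t)‖ ≤ ξ * (1 + α + β) ^ 3 * τ ^ 3 := by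
  have hc : t + τ / 2 ∈ s :=
    h.convex.ordConnected.out ht htτ ⟨by linarith, by linarith⟩
  have hmid := h.norm_midpoint_le hτ ht htτ
  have hhalf := h.norm_drift_apply_le hc (h.norm_half_step_le hτ ht hc)
  have hflow := (h.contraction _ hc).norm_exp_apply_sub_le hτ (h.bound_drift.norm_le hc)
    (h.bound_solution.norm_le ht) 3
  have hgain := h.norm_gain_sub_le hτ ht hc
  have hα := (norm_nonneg _).trans (h.bound_drift.norm_le hc)
  have hβ := (norm_nonneg _).trans (h.bound_jump.norm_le hc)
  have hξ := (norm_nonneg _).trans (h.bound_solution.norm_le hc)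
  rw [sub_expMidpoint_eq]
  calc _ ≤ (α + β) * ξ * τ ^ 3 + τ * (α * ((1 + α) / 4 * ξ * τ ^ 2)) +
          (τ * α) ^ 3 / (3).factorial * ξ +
          τ * (β * (1 / 4 + α ^ 2 / 4 + α * β / 4) * ξ * τ ^ 2) :=
        norm_sub_le_of_le (norm_sub_le_of_le (norm_add_le_of_le hmid
          (norm_smul_le_of_nonneg hτ hhalf)) hflow) (norm_smul_le_of_nonneg hτ hgain)
    _ = ξ * (α + β + α * (1 + α) / 4 + α ^ 3 / 6 +
          β * (1 / 4 + α ^ 2 / 4 + α * β / 4)) * τ ^ 3 := by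
        norm_num [Nat.factorial]
        ring
    _ ≤ ξ * (1 + α + β) ^ 3 * τ ^ 3 := by
        gcongr
        have hpos : 0 ≤ 1 + 7 / 4 * α + 7 / 4 * β + 11 / 4 * α ^ 2 + 6 * α * β + 3 * β ^ 2 +
          5 / 6 * α ^ 3 + 11 / 4 * α ^ 2 * β + 11 / 4 * α * β ^ 2 + β ^ 3 := by positivity
        linarith

end IsBoundedSolution

end ExponentialMidpoint

section GlobalError

variable {E : Type*} [NormedAddCommGroup E] [NormedSpace ℝ E]

lemma seminorm_add_le_of_le (p : Seminorm ℝ E) {u v : E} {a b : ℝ} (hu : p u ≤ a) (hv : p v ≤ b) :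
    p (u + v) ≤ a + b :=
  (map_add_le_add p u v).trans (add_le_add hu hv)

lemma seminorm_expMidpoint_le (p : Seminorm ℝ E) {𝓐 𝓙 : ℝ → E →L[ℝ] E} {s : Set ℝ} {c τ t : ℝ}
    (hexp : ∀ t ∈ s, ∀ h : ℝ, 0 ≤ h → ∀ v, p (exp (h • 𝓐 t) v) ≤ p v)
    (hjump : ∀ t ∈ s, ∀ v, p (𝓙 t v) ≤ c * p v) (hc : 0 ≤ c) (hτ : 0 ≤ τ) (ht : t ∈ s)
    (hmid : t + τ / 2 ∈ s) (v : E) :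
    p (expMidpoint 𝓐 𝓙 τ t v) ≤ Real.exp (c * τ) * p v := by
  have hτ' : 0 ≤ τ / 2 := by positivity
  have hp : ∀ {r C : ℝ} {w : E}, 0 ≤ r → p w ≤ C → p (r • w) ≤ r * C := fun hr hw =>
    (map_smul_eq_mul p _ _).trans_le (by rw [Real.norm_of_nonneg hr]; gcongr)
  have hhalf : p (expMidpointHalf 𝓐 𝓙 τ t v) ≤ p v + τ / 2 * (c * p v) :=
    (hexp t ht _ hτ' _).trans
      (seminorm_add_le_of_le p le_rfl (hp hτ' (hjump t ht v)))
  calc p (expMidpoint 𝓐 𝓙 τ t v)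
      ≤ p v + τ * (c * (p v + τ / 2 * (c * p v))) :=
        seminorm_add_le_of_le p (hexp _ hmid τ hτ v) (hp hτ ((hexp _ hmid _ hτ' _).trans
          ((hjump _ hmid _).trans (by gcongr; exact hhalf))))
    _ = (1 + c * τ + (c * τ) ^ 2 / 2) * p v := by ring
    _ ≤ Real.exp (c * τ) * p v := by
        gcongr
        exact Real.quadratic_le_exp_of_nonneg (by positivity)

lemma C₃_mono {C₁ C₂ s t : ℝ} (h₁ : 0 ≤ C₁) (h₂ : 0 ≤ C₂) (h : s ≤ t) :
    C₃ C₁ C₂ s ≤ C₃ C₁ C₂ t := by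
  unfold C₃
  split_ifs <;> gcongr

lemma C₃_pos {C₁ C₂ T : ℝ} (h₁ : 0 < C₁) (h₂ : 0 ≤ C₂) (hT : 0 < T) : 0 < C₃ C₁ C₂ T := by
  unfold C₃
  split_ifs with h
  · positivity
  · have hC₂ : 0 < C₂ := h₂.lt_of_ne' h
    have hexp : 1 < Real.exp (C₂ * T) := Real.one_lt_exp_iff.2 (mul_pos hC₂ hT)
    exact mul_pos (div_pos h₁ hC₂) (sub_pos.2 hexp)

lemma C₃_step_le {C₁ C₂ τ t : ℝ} (h₁ : 0 ≤ C₁) (h₂ : 0 ≤ C₂) :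
    C₁ * τ + Real.exp (C₂ * τ) * C₃ C₁ C₂ t ≤ C₃ C₁ C₂ (t + τ) := by
  unfold C₃
  split_ifs with h
  · simp only [h, zero_mul, Real.exp_zero]
    linarith
  · have hτ : C₁ * τ ≤ C₁ / C₂ * (Real.exp (C₂ * τ) - 1) := calc
      C₁ * τ = C₁ / C₂ * (C₂ * τ) := by field_simp
      _ ≤ _ := by
        gcongr
        linarith [Real.add_one_le_exp (C₂ * τ)]
    rw [mul_add, Real.exp_add]
    linarith

/-- Local errors `C₁ τ³` accumulate to a global error `C₃ τ²`: each of them is propagated by the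
steps that follow it, which are stable in the seminorm `p`. -/
theorem seminorm_sub_le_C₃ (p : Seminorm ℝ E) {Φ : ℕ → E →L[ℝ] E} {x y : ℕ → E} {N : ℕ}
    {C₁ C₂ τ : ℝ} (h₁ : 0 ≤ C₁) (h₂ : 0 ≤ C₂) (hzero : y 0 = x 0)
    (hsucc : ∀ n, y (n + 1) = Φ n (y n))
    (hstab : ∀ n < N, ∀ v, p (Φ n v) ≤ Real.exp (C₂ * τ) * p v)
    (hlocal : ∀ n < N, p (x (n + 1) - Φ n (x n)) ≤ C₁ * τ ^ 3) :
    ∀ n ≤ N, p (x n - y n) ≤ C₃ C₁ C₂ (n * τ) * τ ^ 2 := by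
  intro n
  induction n with
  | zero => simp [hzero, C₃]
  | succ n ih =>
    intro hn
    have hsplit : x (n + 1) - y (n + 1) = (x (n + 1) - Φ n (x n)) + Φ n (x n - y n) := by
      rw [hsucc, map_sub, sub_add_sub_cancel]
    calc p (x (n + 1) - y (n + 1))
        ≤ C₁ * τ ^ 3 + Real.exp (C₂ * τ) * (C₃ C₁ C₂ (n * τ) * τ ^ 2) := by
          rw [hsplit]
          refine seminorm_add_le_of_le p (hlocal n hn) ((hstab n hn _).trans ?_)
          gcongr
          exact ih (Nat.le_of_succ_le hn)
      _ = (C₁ * τ + Real.exp (C₂ * τ) * C₃ C₁ C₂ (n * τ)) * τ ^ 2 := by ring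
      _ ≤ C₃ C₁ C₂ (n * τ + τ) * τ ^ 2 := by gcongr; exact C₃_step_le h₁ h₂
      _ = C₃ C₁ C₂ ((n + 1 : ℕ) * τ) * τ ^ 2 := by rw [Nat.cast_succ, add_one_mul]

end GlobalError

section TraceNorm

open Matrix
open scoped Matrix.Norms.L2Operator

section L2Operator

variable {n : Type*} [Fintype n] [DecidableEq n]

lemma norm_entry_le (X : Matrix n n ℂ) (i j : n) : ‖X i j‖ ≤ ‖X‖ := by
  have h := Matrix.l2_opNorm_mulVec X (EuclideanSpace.single j 1)
  rw [PiLp.norm_single, norm_one, mul_one] at h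
  simpa using (PiLp.norm_apply_le _ i).trans h

lemma norm_trace_le (X : Matrix n n ℂ) : ‖X.trace‖ ≤ Fintype.card n * ‖X‖ :=
  (norm_sum_le_of_le _ fun i _ => norm_entry_le X i i).trans_eq (by simp)

lemma norm_single_le (i j : n) (c : ℂ) : ‖single i j c‖ ≤ ‖c‖ := by
  have h : ‖single i j c‖ ^ 2 ≤ ‖c‖ ^ 2 := by
    rw [sq, ← l2_opNorm_conjTranspose_mul_self, conjTranspose_single, single_mul_single_same,
      ← diagonal_single, l2_opNorm_diagonal, Pi.norm_single, norm_mul, norm_star, sq]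
  exact (sq_le_sq₀ (norm_nonneg _) (norm_nonneg _)).1 h

lemma norm_le_of_conjTranspose_mul_self_eq_diagonal {W : Matrix n n ℂ} {d : n → ℂ} {c : ℝ}
    (hW : Wᴴ * W = diagonal d) (hc : 0 ≤ c) (hd : ∀ i, ‖d i‖ ≤ c ^ 2) : ‖W‖ ≤ c := by
  refine (sq_le_sq₀ (norm_nonneg _) hc).1 ?_
  rw [sq, ← l2_opNorm_conjTranspose_mul_self, hW, l2_opNorm_diagonal]
  exact (pi_norm_le_iff_of_nonneg (sq_nonneg c)).2 hd

lemma norm_mul_apply_le {P W : Matrix n n ℂ} {σ : n → ℝ} (hσ : ∀ i, 0 ≤ σ i)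
    (hW : Wᴴ * W = diagonal fun i => (σ i : ℂ) ^ 2) (i j : n) :
    ‖(P * W) i j‖ ≤ ‖P‖ * σ j := by
  have hcol : ‖W * single j j 1‖ ≤ σ j := by
    refine norm_le_of_conjTranspose_mul_self_eq_diagonal (d := Pi.single j ((σ j : ℂ) ^ 2)) ?_
      (hσ j) fun k => ?_
    · rw [conjTranspose_mul, conjTranspose_single, star_one, Matrix.mul_assoc,
        ← Matrix.mul_assoc Wᴴ, hW, ← Matrix.mul_assoc, single_mul_mul_single, diagonal_single]
      simp
    · refine (norm_le_pi_norm (Pi.single j ((σ j : ℂ) ^ 2) : n → ℂ) k).trans_eq ?_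
      rw [Pi.norm_single, norm_pow, Complex.norm_real, Real.norm_of_nonneg (hσ j)]
  calc ‖(P * W) i j‖ = ‖(P * (W * single j j (1 : ℂ)) : Matrix n n ℂ) i j‖ := by
        simp [← Matrix.mul_assoc]
    _ ≤ ‖P‖ * ‖W * single j j 1‖ := (norm_entry_le _ i j).trans (norm_mul_le _ _)
    _ ≤ ‖P‖ * σ j := by gcongr

end L2Operator

variable {m : ℕ}

/-- The right half of a singular value decomposition: the columns of `X V` are orthogonal and their
lengths are the singular values of `X`. -/
lemma exists_singularValues (X : Matrix (Fin m) (Fin m) ℂ) :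
    ∃ (σ : Fin m → ℝ) (V : unitaryGroup (Fin m) ℂ), (∀ i, 0 ≤ σ i) ∧ traceNorm X = ∑ i, σ i ∧
      (X * (V : Matrix (Fin m) (Fin m) ℂ))ᴴ * (X * (V : Matrix (Fin m) (Fin m) ℂ)) =
        diagonal fun i => (σ i : ℂ) ^ 2 := by
  set hX := isHermitian_conjTranspose_mul_self X
  refine ⟨fun i => √(hX.eigenvalues i), hX.eigenvectorUnitary, fun i => Real.sqrt_nonneg _, rfl, ?_⟩
  have hdiag := hX.conjStarAlgAut_star_eigenvectorUnitary
  rw [Unitary.conjStarAlgAut_star_apply] at hdiag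
  rw [conjTranspose_mul, Matrix.mul_assoc, ← Matrix.mul_assoc Xᴴ, ← Matrix.mul_assoc,
    ← star_eq_conjTranspose (hX.eigenvectorUnitary : Matrix (Fin m) (Fin m) ℂ), hdiag]
  congr 1
  ext i
  rw [← Complex.ofReal_pow,
    Real.sq_sqrt ((posSemidef_conjTranspose_mul_self X).eigenvalues_nonneg i)]
  rfl

lemma norm_trace_mul_le (U X : Matrix (Fin m) (Fin m) ℂ) :
    ‖(U * X).trace‖ ≤ ‖U‖ * traceNorm X := by
  obtain ⟨σ, V, hσ, hsum, hW⟩ := exists_singularValues X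
  have htrace : (U * X).trace = (((star V : unitaryGroup (Fin m) ℂ) : Matrix _ _ ℂ) * U *
      (X * (V : Matrix (Fin m) (Fin m) ℂ))).trace := by
    rw [← Matrix.mul_assoc, trace_mul_comm _ (V : Matrix (Fin m) (Fin m) ℂ), ← Matrix.mul_assoc,
      ← Matrix.mul_assoc, Unitary.coe_star, Unitary.mul_star_self_of_mem V.2, Matrix.one_mul]
  rw [htrace, hsum, Finset.mul_sum, ← CStarRing.norm_coe_unitary_mul (star V) U]
  exact norm_sum_le_of_le _ fun i _ => norm_mul_apply_le hσ hW i i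

lemma exists_trace_mul_eq_traceNorm (X : Matrix (Fin m) (Fin m) ℂ) :
    ∃ U : Matrix (Fin m) (Fin m) ℂ, ‖U‖ ≤ 1 ∧ (U * X).trace = traceNorm X := by
  obtain ⟨σ, V, -, hsum, hW⟩ := exists_singularValues X
  set W := X * (V : Matrix (Fin m) (Fin m) ℂ) with hW_def
  set D : Matrix (Fin m) (Fin m) ℂ := diagonal fun i => (σ i : ℂ)⁻¹ with hD
  have hDstar : Dᴴ = D := by
    rw [hD, diagonal_conjTranspose]
    congr 1
    ext i
    simp
  refine ⟨V * (D * Wᴴ), ?_, ?_⟩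
  · rw [CStarRing.norm_coe_unitary_mul, ← l2_opNorm_conjTranspose, conjTranspose_mul,
      conjTranspose_conjTranspose, hDstar]
    refine norm_le_of_conjTranspose_mul_self_eq_diagonal
      (d := fun i => (σ i : ℂ)⁻¹ * (σ i ^ 2 * (σ i : ℂ)⁻¹)) ?_ zero_le_one fun i => ?_
    · rw [conjTranspose_mul, hDstar, Matrix.mul_assoc, ← Matrix.mul_assoc Wᴴ, hW, hD,
        diagonal_mul_diagonal, diagonal_mul_diagonal]
    · rw [show (σ i : ℂ)⁻¹ * (σ i ^ 2 * (σ i : ℂ)⁻¹) = (σ i * (σ i : ℂ)⁻¹) ^ 2 by ring, norm_pow,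
        norm_mul, norm_inv]
      gcongr
      exact mul_inv_le_one
  · rw [Matrix.mul_assoc, trace_mul_comm, Matrix.mul_assoc, Matrix.mul_assoc, ← hW_def, hW, hD,
      diagonal_mul_diagonal, trace_diagonal, hsum, Complex.ofReal_sum]
    refine Finset.sum_congr rfl fun i _ => ?_
    by_cases h : (σ i : ℂ) = 0
    · simp [h]
    · field_simp

lemma traceNorm_le_of_forall_norm_trace_le {X : Matrix (Fin m) (Fin m) ℂ} {c : ℝ}
    (h : ∀ U : Matrix (Fin m) (Fin m) ℂ, ‖U‖ ≤ 1 → ‖(U * X).trace‖ ≤ c) : traceNorm X ≤ c := by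
  obtain ⟨U, hU, htrace⟩ := exists_trace_mul_eq_traceNorm X
  calc traceNorm X ≤ ‖(traceNorm X : ℂ)‖ := by
        rw [Complex.norm_real]
        exact Real.le_norm_self _
    _ ≤ c := htrace ▸ h U hU

lemma traceNorm_nonneg (X : Matrix (Fin m) (Fin m) ℂ) : 0 ≤ traceNorm X :=
  Finset.sum_nonneg fun _ _ => Real.sqrt_nonneg _

lemma norm_trace_mul_le_of_norm_le_one {U : Matrix (Fin m) (Fin m) ℂ} (hU : ‖U‖ ≤ 1)
    (X : Matrix (Fin m) (Fin m) ℂ) : ‖(U * X).trace‖ ≤ traceNorm X :=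
  (norm_trace_mul_le U X).trans (mul_le_of_le_one_left (traceNorm_nonneg X) hU)

variable (m) in
/-- The trace norm, bundled as a seminorm. -/
def traceSeminorm : Seminorm ℝ (Matrix (Fin m) (Fin m) ℂ) :=
  Seminorm.ofSMulLE traceNorm
    ((traceNorm_le_of_forall_norm_trace_le fun U _ => by simp).antisymm (traceNorm_nonneg 0))
    (fun X Y => traceNorm_le_of_forall_norm_trace_le fun U hU => by
      rw [mul_add, trace_add]
      exact norm_add_le_of_le (norm_trace_mul_le_of_norm_le_one hU X)
        (norm_trace_mul_le_of_norm_le_one hU Y))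
    (fun r X => traceNorm_le_of_forall_norm_trace_le fun U hU => by
      rw [mul_smul_comm, trace_smul, norm_smul]
      gcongr
      exact norm_trace_mul_le_of_norm_le_one hU X)

lemma traceNorm_mul_mul_le (P X Q : Matrix (Fin m) (Fin m) ℂ) :
    traceNorm (P * X * Q) ≤ ‖P‖ * ‖Q‖ * traceNorm X := by
  refine traceNorm_le_of_forall_norm_trace_le fun U hU => ?_
  have hcycle : (U * (P * X * Q)).trace = (Q * U * P * X).trace := by
    rw [← Matrix.mul_assoc, trace_mul_comm]
    simp only [Matrix.mul_assoc]
  rw [hcycle]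
  refine (norm_trace_mul_le _ X).trans ?_
  gcongr
  · exact traceNorm_nonneg X
  · calc ‖Q * U * P‖ ≤ ‖Q‖ * ‖U‖ * ‖P‖ := norm_mul₃_le
      _ ≤ ‖Q‖ * 1 * ‖P‖ := by gcongr
      _ = ‖P‖ * ‖Q‖ := by ring

lemma norm_le_traceNorm (X : Matrix (Fin m) (Fin m) ℂ) : ‖X‖ ≤ traceNorm X := by
  obtain ⟨σ, V, hσ, hsum, hW⟩ := exists_singularValues X
  rw [← CStarRing.norm_mul_coe_unitary X V]
  refine norm_le_of_conjTranspose_mul_self_eq_diagonal hW (traceNorm_nonneg X) fun i => ?_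
  rw [norm_pow, Complex.norm_real, Real.norm_of_nonneg (hσ i), hsum]
  gcongr
  · exact hσ i
  · exact Finset.single_le_sum (fun j _ => hσ j) (Finset.mem_univ i)

lemma traceNorm_le_mul_norm (X : Matrix (Fin m) (Fin m) ℂ) : traceNorm X ≤ m * ‖X‖ :=
  traceNorm_le_of_forall_norm_trace_le fun U hU => calc
    ‖(U * X).trace‖ ≤ m * ‖U * X‖ := by simpa using norm_trace_le (U * X)
    _ ≤ m * (1 * ‖X‖) := by grw [norm_mul_le, hU]
    _ = m * ‖X‖ := by rw [one_mul]

end TraceNorm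

section MatrixValued

open Matrix

section Entries

variable {n : Type*} [Finite n] {f : ℝ → Matrix n n ℂ} {s : Set ℝ}

variable (n) in
/-- A matrix as a continuous linear function of its table of entries. -/
def ofEntries : (n → n → ℂ) ≃L[ℝ] Matrix n n ℂ :=
  (ofLinearEquiv ℝ : (n → n → ℂ) ≃ₗ[ℝ] Matrix n n ℂ).toContinuousLinearEquiv

lemma hasDerivWithinAt_matrix {f' : Matrix n n ℂ} {t : ℝ}
    (hf : ∀ i j, HasDerivWithinAt (fun t => f t i j) (f' i j) s t) : HasDerivWithinAt f f' s t := by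
  classical
  cases nonempty_fintype n
  open scoped Matrix.Norms.L2Operator in
  exact (ofEntries n).hasFDerivAt.comp_hasDerivWithinAt t
    (hasDerivWithinAt_pi.2 fun i => hasDerivWithinAt_pi.2 (hf i))

end Entries

open scoped Matrix.Norms.L2Operator

variable {n : Type*} [Fintype n] [DecidableEq n]

lemma generatesContractions_of_posSemidef {a : Matrix n n ℂ} (ha : (-(a + aᴴ)).PosSemidef) :
    GeneratesContractions a := by
  have hdiss : ∀ v, (inner ℂ v (toEuclideanCLM (𝕜 := ℂ) a v)).re ≤ 0 := by
    intro v
    have hstar : star v.ofLp ⬝ᵥ (aᴴ *ᵥ v.ofLp) = star (star v.ofLp ⬝ᵥ (a *ᵥ v.ofLp)) := by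
      rw [star_dotProduct, star_mulVec, conjTranspose_conjTranspose, ← dotProduct_mulVec]
    have hinner : inner ℂ v (toEuclideanCLM (𝕜 := ℂ) a v) = star v.ofLp ⬝ᵥ (a *ᵥ v.ofLp) := by
      rw [EuclideanSpace.inner_eq_star_dotProduct, ofLp_toEuclideanCLM, dotProduct_comm]
    have hnonneg := ha.re_dotProduct_nonneg v.ofLp
    rw [neg_mulVec, add_mulVec, dotProduct_neg, dotProduct_add, hstar, ← hinner] at hnonneg
    simp only [RCLike.star_def, RCLike.re_eq_complex_re, Complex.neg_re, Complex.add_re,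
      Complex.conj_re] at hnonneg
    linarith
  intro h hh
  let T : Matrix n n ℂ →+* (EuclideanSpace ℂ n →L[ℂ] EuclideanSpace ℂ n) :=
    RingHomClass.toRingHom (toEuclideanCLM (n := n) (𝕜 := ℂ))
  have hT : Isometry T := AddMonoidHomClass.isometry_of_norm T fun _ => rfl
  calc ‖exp (h • a)‖ = ‖exp (h • T a)‖ := by
        rw [← hT.norm_map_of_map_zero (map_zero T), ← exp_map T hT.continuous,
          map_real_smul T hT.continuous]
    _ ≤ 1 := generatesContractions_of_re_inner_nonpos hdiss h hh

variable {f : ℝ → Matrix n n ℂ} {s : Set ℝ}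

lemma contDiffOn_matrix_iff {k : WithTop ℕ∞} :
    ContDiffOn ℝ k f s ↔ ∀ i j, ContDiffOn ℝ k (fun t => f t i j) s :=
  ((ofEntries n).comp_contDiffOn_iff (f := fun t i j => f t i j)).trans
    (contDiffOn_pi.trans (forall_congr' fun _ => contDiffOn_pi))

lemma norm_matrix_le {X : Matrix n n ℂ} {C : ℝ} (hX : ∀ i j, ‖X i j‖ ≤ C) :
    ‖X‖ ≤ Fintype.card n ^ 2 * C := by
  rw [matrix_eq_sum_single X]
  calc _ ≤ ∑ _i : n, ∑ _j : n, C := norm_sum_le_of_le _ fun i _ => norm_sum_le_of_le _ fun j _ =>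
        (norm_single_le i j _).trans (hX i j)
    _ = Fintype.card n ^ 2 * C := by simp [sq, mul_assoc]

lemma iteratedDerivWithin_matrix_apply (hs : UniqueDiffOn ℝ s) {k : ℕ} (hf : ContDiffOn ℝ k f s)
    {t : ℝ} (ht : t ∈ s) (i j : n) :
    iteratedDerivWithin k f s t i j = iteratedDerivWithin k (fun t => f t i j) s t := by
  let L : Matrix n n ℂ →L[ℝ] ℂ := (.proj j : (n → ℂ) →L[ℝ] ℂ) ∘L
    (.proj i : (n → n → ℂ) →L[ℝ] n → ℂ) ∘L (ofEntries n).symm.toContinuousLinearMap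
  have h := L.iteratedFDerivWithin_comp_left (hf t ht) hs ht le_rfl
  exact (DFunLike.congr_fun h fun _ => 1).symm

lemma ContDiffBoundOn.matrix {k : ℕ} {C : ℝ} (hs : UniqueDiffOn ℝ s)
    (hf : ∀ i j, ContDiffBoundOn k (fun t => f t i j) s C) :
    ContDiffBoundOn k f s (Fintype.card n ^ 2 * C) := by
  have hf' := contDiffOn_matrix_iff.2 fun i j => (hf i j).contDiffOn
  refine ⟨hf', fun l hl t ht => norm_matrix_le fun i j => ?_⟩
  rw [iteratedDerivWithin_matrix_apply hs (hf'.of_le (mod_cast hl)) ht]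
  exact (hf i j).norm_iteratedDerivWithin_le l hl t ht

end MatrixValued

namespace LindbladData

open Matrix
open scoped Matrix.Norms.L2Operator

variable {m K : ℕ} (S : LindbladData m K) {T M : ℝ} {ρ : ℝ → Matrix (Fin m) (Fin m) ℂ}

/-- The part `X ↦ A(t) X + X A(t)†` of the Lindblad operator, which the scheme exponentiates. -/
def drift (t : ℝ) : Matrix (Fin m) (Fin m) ℂ →L[ℝ] Matrix (Fin m) (Fin m) ℂ :=
  lyapunov (S.A t)

/-- The gain term `X ↦ ∑ k, γ_k(t) L_k X L_k†` of the Lindblad operator. -/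
def jump (t : ℝ) : Matrix (Fin m) (Fin m) ℂ →L[ℝ] Matrix (Fin m) (Fin m) ℂ :=
  ∑ k, S.γ k t • ContinuousLinearMap.mulLeftRight ℝ _ (S.L k) (S.L k)ᴴ

lemma jump_apply (t : ℝ) (X : Matrix (Fin m) (Fin m) ℂ) :
    S.jump t X = ∑ k, (S.γ k t : ℂ) • (S.L k * X * (S.L k)ᴴ) := by
  simp [jump, Complex.coe_smul]

lemma exp_drift_apply (h t : ℝ) (X : Matrix (Fin m) (Fin m) ℂ) :
    exp (h • S.drift t) X = S.E h t * X * exp ((h : ℂ) • (S.A t)ᴴ) := by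
  rw [drift, ← map_smul, exp_lyapunov_apply, star_exp, star_smul, star_trivial, E, Complex.coe_smul,
    Complex.coe_smul, star_eq_conjTranspose]

lemma halfStep_eq_expMidpointHalf (τ t : ℝ) (X : Matrix (Fin m) (Fin m) ℂ) :
    S.halfStep τ t X = expMidpointHalf S.drift S.jump τ t X := by
  simp only [halfStep, expMidpointHalf, mul_apply_eq_comp, _root_.add_apply, one_apply_eq_self,
    _root_.smul_apply, exp_drift_apply, jump_apply, Complex.coe_smul]

lemma step_eq_expMidpoint (τ t : ℝ) (X : Matrix (Fin m) (Fin m) ℂ) :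
    S.step τ t X = expMidpoint S.drift S.jump τ t X := by
  simp only [step, expMidpoint, _root_.add_apply, _root_.smul_apply, mul_apply_eq_comp,
    exp_drift_apply, jump_apply, halfStep_eq_expMidpointHalf, Finset.mul_sum, Finset.sum_mul,
    mul_smul_comm, smul_mul_assoc, Matrix.mul_assoc, Complex.coe_smul]

namespace Admissible

variable {S} (hS : S.Admissible T) {t : ℝ} (ht : t ∈ Icc 0 T)
include hS

section
include ht

lemma conjTranspose_A :
    (S.A t)ᴴ = Complex.I • S.H t - (1 / 2 : ℂ) • ∑ k, (S.γ k t : ℂ) • ((S.L k)ᴴ * S.L k) := by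
  simp only [A, Matrix.conjTranspose_sub, Matrix.conjTranspose_smul, Matrix.conjTranspose_sum,
    Matrix.conjTranspose_mul, Matrix.conjTranspose_conjTranspose, (hS.hermitian t ht).eq]
  simp

lemma rhs_eq_drift_add_jump (X : Matrix (Fin m) (Fin m) ℂ) :
    S.rhs t X = S.drift t X + S.jump t X := by
  rw [drift, lyapunov_apply, star_eq_conjTranspose, jump_apply, hS.conjTranspose_A ht, rhs, A]
  simp only [smul_sub, Finset.sum_sub_distrib, sub_mul, mul_sub, smul_mul_assoc, mul_smul_comm,
    Finset.sum_mul, Finset.mul_sum, smul_add, Finset.sum_add_distrib, Finset.smul_sum,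
    smul_comm (1 / 2 : ℂ)]
  module

lemma generatesContractions_A : GeneratesContractions (S.A t) := by
  have hsum : -(S.A t + (S.A t)ᴴ) = ∑ k, (S.γ k t : ℂ) • ((S.L k)ᴴ * S.L k) := by
    rw [hS.conjTranspose_A ht, A]
    module
  refine generatesContractions_of_posSemidef (hsum ▸ posSemidef_sum _ fun k _ => ?_)
  exact (posSemidef_conjTranspose_mul_self (S.L k)).smul (mod_cast hS.nonneg k t ht)

lemma le_sSup_γ (k : Fin K) : S.γ k t ≤ sSup (S.γ k '' Icc 0 T) :=
  le_csSup (isCompact_Icc.image_of_continuousOn (hS.contDiffOn_γ k).continuousOn).bddAbove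
    (mem_image_of_mem _ ht)

lemma traceSeminorm_exp_drift_le {h : ℝ} (hh : 0 ≤ h) (X : Matrix (Fin m) (Fin m) ℂ) :
    traceSeminorm m (exp (h • S.drift t) X) ≤ traceSeminorm m X := by
  have hE := hS.generatesContractions_A ht h hh
  rw [drift, ← map_smul, exp_lyapunov_apply]
  calc traceNorm (exp (h • S.A t) * X * star (exp (h • S.A t)))
      ≤ ‖exp (h • S.A t)‖ * ‖star (exp (h • S.A t))‖ * traceNorm X := traceNorm_mul_mul_le _ _ _
    _ ≤ 1 * 1 * traceNorm X := by
        rw [norm_star]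
        gcongr
        exact traceNorm_nonneg X
    _ = traceNorm X := by rw [one_mul, one_mul]

lemma traceSeminorm_jump_le (X : Matrix (Fin m) (Fin m) ℂ) :
    traceSeminorm m (S.jump t X) ≤ S.C₂ T * traceSeminorm m X := by
  have hchannel : ∀ k, traceNorm (S.L k * X * (S.L k)ᴴ) ≤ traceNorm (S.L k) ^ 2 * traceNorm X := by
    intro k
    refine (traceNorm_mul_mul_le _ _ _).trans ?_
    rw [l2_opNorm_conjTranspose, ← sq]
    gcongr
    · exact traceNorm_nonneg X
    · exact norm_le_traceNorm _
  calc traceSeminorm m (S.jump t X)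
      ≤ ∑ k, traceSeminorm m (S.γ k t • (S.L k * X * (S.L k)ᴴ)) := by
        rw [jump_apply]
        exact Finset.le_sum_of_subadditive _ (map_zero (traceSeminorm m)).le (map_add_le_add _) _ _
    _ ≤ ∑ k, sSup (S.γ k '' Icc 0 T) * (traceNorm (S.L k) ^ 2 * traceNorm X) := by
        refine Finset.sum_le_sum fun k _ => ?_
        rw [map_smul_eq_mul, Real.norm_of_nonneg (hS.nonneg k t ht)]
        exact mul_le_mul (hS.le_sSup_γ ht k) (hchannel k) (traceNorm_nonneg _)
          ((hS.nonneg k t ht).trans (hS.le_sSup_γ ht k))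
    _ = S.C₂ T * traceSeminorm m X := by
        simp only [C₂, Finset.sum_mul, mul_assoc]
        rfl

end

lemma C₂_nonneg (hT : 0 ≤ T) : 0 ≤ S.C₂ T :=
  Finset.sum_nonneg fun k _ => mul_nonneg
    ((hS.nonneg k 0 ⟨le_rfl, hT⟩).trans (hS.le_sSup_γ ⟨le_rfl, hT⟩ k)) (sq_nonneg _)

lemma contDiffOn_A : ContDiffOn ℝ 2 S.A (Icc 0 T) := by
  have hH : ContDiffOn ℝ 2 S.H (Icc 0 T) := contDiffOn_matrix_iff.2 hS.contDiffOn_H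
  have hγ : ∀ k, ContDiffOn ℝ 2 (fun t => (S.γ k t : ℂ)) (Icc 0 T) := fun k =>
    Complex.ofRealCLM.contDiff.comp_contDiffOn (hS.contDiffOn_γ k)
  exact (hH.const_smul (-Complex.I)).sub
    ((ContDiffOn.sum fun k _ => (hγ k).smul contDiffOn_const).const_smul (1 / 2 : ℂ))

lemma contDiffOn_drift_add_jump : ContDiffOn ℝ 2 (fun t => S.drift t + S.jump t) (Icc 0 T) :=
  have hdrift : ContDiffOn ℝ 2 S.drift (Icc 0 T) :=
    (lyapunov (R := Matrix (Fin m) (Fin m) ℂ)).contDiff.comp_contDiffOn hS.contDiffOn_A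
  have hjump : ContDiffOn ℝ 2 S.jump (Icc 0 T) :=
    ContDiffOn.sum fun k _ => (hS.contDiffOn_γ k).smul contDiffOn_const
  hdrift.add hjump

end Admissible

variable {S}

lemma IsSolution.hasDerivWithinAt (hρ : S.IsSolution T ρ) (hS : S.Admissible T) {t : ℝ}
    (ht : t ∈ Icc 0 T) : HasDerivWithinAt ρ (S.drift t (ρ t) + S.jump t (ρ t)) (Icc 0 T) t :=
  hS.rhs_eq_drift_add_jump ht (ρ t) ▸ hasDerivWithinAt_matrix (hρ t ht)

lemma IsSolution.contDiffOn (hρ : S.IsSolution T ρ) (hS : S.Admissible T) (hT : 0 < T) :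
    ContDiffOn ℝ 2 ρ (Icc 0 T) := by
  have h := contDiffOn_succ_of_linear_ode (n := 1) (uniqueDiffOn_Icc hT)
    (hS.contDiffOn_drift_add_jump.of_le (mod_cast one_le_two)) fun t ht => hρ.hasDerivWithinAt hS ht
  simpa [one_add_one_eq_two] using h

lemma IsSolution.exists_boundedBy (hρ : S.IsSolution T ρ) (hS : S.Admissible T) (hT : 0 < T) :
    ∃ M, S.BoundedBy T M ρ := by
  have hU := uniqueDiffOn_Icc hT
  have hA := contDiffOn_matrix_iff.1 hS.contDiffOn_A
  have hρ' := contDiffOn_matrix_iff.1 (hρ.contDiffOn hS hT)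
  have hM : ∀ᶠ M in Filter.atTop, (∀ k a b, ‖S.L k a b‖ ≤ M) ∧
      (∀ k, ContDiffBoundOn 2 (S.γ k) (Icc 0 T) M) ∧
      (∀ a b, ContDiffBoundOn 2 (fun t => S.A t a b) (Icc 0 T) M) ∧
      ∀ a b, ContDiffBoundOn 2 (fun t => ρ t a b) (Icc 0 T) M := by
    simp only [Filter.eventually_and, Filter.eventually_all]
    exact ⟨fun k a b => Filter.eventually_ge_atTop _,
      fun k => eventually_contDiffBoundOn isCompact_Icc hU (hS.contDiffOn_γ k),
      fun a b => eventually_contDiffBoundOn isCompact_Icc hU (hA a b),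
      fun a b => eventually_contDiffBoundOn isCompact_Icc hU (hρ' a b)⟩
  obtain ⟨M, hL, hγ, hA, hρ⟩ := hM.exists
  exact ⟨M, hL, fun k => (hγ k).norm_iteratedDerivWithin_le,
    fun a b => (hA a b).norm_iteratedDerivWithin_le,
    fun a b => (hρ a b).norm_iteratedDerivWithin_le⟩

lemma BoundedBy.isBoundedSolution (hM : S.BoundedBy T M ρ) (hS : S.Admissible T) (hT : 0 < T)
    (hρ : S.IsSolution T ρ) :
    IsBoundedSolution S.drift S.jump ρ (Icc 0 T) (2 * (m ^ 2 * M)) (K * ((m ^ 2 * M) ^ 2 * M))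
      (m ^ 2 * M) := by
  have hU := uniqueDiffOn_Icc hT
  have hA' := contDiffOn_matrix_iff.1 hS.contDiffOn_A
  have hρ' := contDiffOn_matrix_iff.1 (hρ.contDiffOn hS hT)
  have hA : ContDiffBoundOn 2 S.A (Icc 0 T) (m ^ 2 * M) := by
    simpa using ContDiffBoundOn.matrix hU fun a b => ⟨hA' a b, hM.bound_A a b⟩
  have hL : ∀ k, ‖S.L k‖ ≤ m ^ 2 * M := fun k => by simpa using norm_matrix_le (hM.bound_L k)
  have hγ : ∀ k, ContDiffBoundOn 2 (S.γ k) (Icc 0 T) M := fun k =>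
    ⟨hS.contDiffOn_γ k, hM.bound_γ k⟩
  refine ⟨hU, convex_Icc 0 T, fun t ht => (hS.generatesContractions_A ht).lyapunov, ?_, ?_, ?_,
    fun t ht => hρ.hasDerivWithinAt hS ht⟩
  · refine (hA.clm_comp hU lyapunov).mono ?_
    gcongr
    · exact (norm_nonneg _).trans (hA.norm_le (left_mem_Icc.2 hT.le))
    · exact norm_lyapunov_le
  · refine (ContDiffBoundOn.sum hU fun k _ => ((hγ k).smul_const hU _).mono
      (D := (m ^ 2 * M) ^ 2 * M) ?_).mono (by simp)
    gcongr
    · exact (norm_nonneg _).trans ((hγ k).norm_le (left_mem_Icc.2 hT.le))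
    · calc _ ≤ ‖S.L k‖ * ‖(S.L k)ᴴ‖ :=
            ContinuousLinearMap.opNorm_mulLeftRight_apply_apply_le ℝ _ _ _
        _ = ‖S.L k‖ ^ 2 := by rw [l2_opNorm_conjTranspose, sq]
        _ ≤ (m ^ 2 * M) ^ 2 := by gcongr; exact hL k
  · simpa using ContDiffBoundOn.matrix hU fun a b => ⟨hρ' a b, hM.bound_ρ a b⟩

end LindbladData

/-- The constant `C₁` of the local error estimate; the absolute value and the summand `1` make it
positive for every `M`. -/
def localErrorConst (m K : ℕ) (M : ℝ) : ℝ :=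
  m * |m ^ 2 * M * (1 + 2 * (m ^ 2 * M) + K * ((m ^ 2 * M) ^ 2 * M)) ^ 3| + 1

lemma localErrorConst_pos (m K : ℕ) (M : ℝ) : 0 < localErrorConst m K M := by
  unfold localErrorConst
  positivity

namespace LindbladData

variable {m K : ℕ} {S : LindbladData m K} {T M : ℝ} {ρ : ℝ → Matrix (Fin m) (Fin m) ℂ} {τ t : ℝ}

lemma BoundedBy.traceNorm_sub_step_le (hM : S.BoundedBy T M ρ) (hS : S.Admissible T) (hT : 0 < T)
    (hρ : S.IsSolution T ρ) (hτ : 0 ≤ τ) (ht : t ∈ Icc 0 T) (htτ : t + τ ∈ Icc 0 T) :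
    traceNorm (ρ (t + τ) - S.step τ t (ρ t)) ≤ localErrorConst m K M * τ ^ 3 := by
  open scoped Matrix.Norms.L2Operator in
  set C := m ^ 2 * M * (1 + 2 * (m ^ 2 * M) + K * ((m ^ 2 * M) ^ 2 * M)) ^ 3
  calc traceNorm (ρ (t + τ) - S.step τ t (ρ t))
      ≤ m * ‖ρ (t + τ) - S.step τ t (ρ t)‖ := traceNorm_le_mul_norm _
    _ ≤ m * (C * τ ^ 3) := by
        rw [step_eq_expMidpoint]
        gcongr
        exact (hM.isBoundedSolution hS hT hρ).norm_sub_expMidpoint_le hτ ht htτ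
    _ ≤ (m * |C| + 1) * τ ^ 3 := by
        rw [← mul_assoc]
        gcongr
        exact (mul_le_mul_of_nonneg_left (le_abs_self C) m.cast_nonneg).trans (by simp)

open scoped Matrix.Norms.L2Operator in
lemma traceNorm_sub_numSol_le {C₁ : ℝ} {N : ℕ} (hS : S.Admissible T) (hT : 0 ≤ T) (hC₁ : 0 ≤ C₁)
    (hτ : 0 ≤ τ) (hNτ : N * τ ≤ T)
    (hlocal : ∀ n : ℕ, n < N →
      traceNorm (ρ ((n + 1) * τ) - S.step τ (n * τ) (ρ (n * τ))) ≤ C₁ * τ ^ 3)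
    {n : ℕ} (hn : n ≤ N) :
    traceNorm (ρ (n * τ) - S.numSol τ (ρ 0) n) ≤ C₃ C₁ (S.C₂ T) T * τ ^ 2 := by
  have hgrid : ∀ {k : ℕ}, k ≤ N → k * τ ≤ T := fun hk => le_trans (by gcongr) hNτ
  have hC₂ : 0 ≤ S.C₂ T := hS.C₂_nonneg hT
  have hstab : ∀ k < N, ∀ X, traceSeminorm m (expMidpoint S.drift S.jump τ (k * τ) X) ≤
      Real.exp (S.C₂ T * τ) * traceSeminorm m X := by
    intro k hk X
    have hkτ : 0 ≤ k * τ := by positivity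
    have hk' : (k + 1) * τ ≤ T := mod_cast hgrid hk
    exact seminorm_expMidpoint_le (traceSeminorm m) (s := Icc 0 T)
      (fun t ht h hh => hS.traceSeminorm_exp_drift_le ht hh)
      (fun t ht => hS.traceSeminorm_jump_le ht) hC₂ hτ
      ⟨hkτ, by linarith⟩ ⟨by linarith, by linarith⟩ X
  calc traceNorm (ρ (n * τ) - S.numSol τ (ρ 0) n)
      ≤ C₃ C₁ (S.C₂ T) (n * τ) * τ ^ 2 :=
        seminorm_sub_le_C₃ (traceSeminorm m) (x := fun k => ρ (k * τ)) hC₁ hC₂ (by simp [numSol])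
          (fun k => S.step_eq_expMidpoint τ (k * τ) _) hstab
          (fun k hk => by simpa [step_eq_expMidpoint] using! hlocal k hk) n hn
    _ ≤ C₃ C₁ (S.C₂ T) T * τ ^ 2 := by
        gcongr
        exact C₃_mono hC₁ hC₂ (hgrid hn)

end LindbladData

end FREM

end

theorem theorem3p1_general (m K : ℕ) :
    ∃ C₁ : ℝ → ℝ, (∀ M : ℝ, 0 < C₁ M) ∧
      ∀ (T : ℝ), 0 < T →
      ∀ (S : FREM.LindbladData m K), S.Admissible T →
      ∀ (ρ : ℝ → Matrix (Fin m) (Fin m) ℂ), S.IsSolution T ρ →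
        (∃ M : ℝ, S.BoundedBy T M ρ) ∧
        ∀ (M : ℝ), S.BoundedBy T M ρ →
          0 < FREM.C₃ (C₁ M) (S.C₂ T) T ∧
          ∀ (N : ℕ), 0 < N → ∀ (τ : ℝ), τ = T / N →
            (∀ n : ℕ, n < N →
              FREM.traceNorm (ρ ((n + 1) * τ) - S.step τ (n * τ) (ρ (n * τ)))
                ≤ C₁ M * τ ^ 3) ∧
            (∀ n : ℕ, n ≤ N →
              FREM.traceNorm (ρ (n * τ) - S.numSol τ (ρ 0) n)
                ≤ FREM.C₃ (C₁ M) (S.C₂ T) T * τ ^ 2) := by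
  have hC₁ : ∀ M, 0 < FREM.localErrorConst m K M := FREM.localErrorConst_pos m K
  refine ⟨FREM.localErrorConst m K, hC₁, fun T hT S hS ρ hρ => ⟨hρ.exists_boundedBy hS hT,
    fun M hM => ⟨FREM.C₃_pos (hC₁ M) (hS.C₂_nonneg hT.le) hT, fun N hN τ hτ => ?_⟩⟩⟩
  have hτ₀ : 0 ≤ τ := hτ ▸ by positivity
  have hNτ : N * τ = T := by rw [hτ]; field_simp
  have hlocal : ∀ n : ℕ, n < N →
      FREM.traceNorm (ρ ((n + 1) * τ) - S.step τ (n * τ) (ρ (n * τ))) ≤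
        FREM.localErrorConst m K M * τ ^ 3 := by
    intro n hn
    have hnτ : 0 ≤ n * τ := by positivity
    have hn' : (n + 1) * τ ≤ T := hNτ ▸ by gcongr; exact_mod_cast hn
    rw [add_one_mul] at hn' ⊢
    exact hM.traceNorm_sub_step_le hS hT hρ hτ₀ ⟨hnτ, by linarith⟩ ⟨by linarith, hn'⟩
  exact ⟨hlocal, fun n hn => FREM.LindbladData.traceNorm_sub_numSol_le hS hT.le (hC₁ M).le hτ₀
    hNτ.le hlocal hn⟩

theorem theorem3p1 (m K : ℕ) :
    ∃ C₁ : ℝ → ℝ, (∀ M : ℝ, 0 < C₁ M) ∧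
      ∀ (T : ℝ), 0 < T →
      ∀ (S : FREM.LindbladData m K), S.Admissible T →
      ∀ (ρ : ℝ → Matrix (Fin m) (Fin m) ℂ), FREM.IsDensityMatrix (ρ 0) → S.IsSolution T ρ →
        (∃ M : ℝ, S.BoundedBy T M ρ) ∧
        ∀ (M : ℝ), S.BoundedBy T M ρ →
          0 < FREM.C₃ (C₁ M) (S.C₂ T) T ∧
          ∀ (N : ℕ), 0 < N → ∀ (τ : ℝ), τ = T / N →
            (∀ n : ℕ, n < N →
              FREM.traceNorm (ρ ((n + 1) * τ) - S.step τ (n * τ) (ρ (n * τ)))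
                ≤ C₁ M * τ ^ 3) ∧
            (∀ n : ℕ, n ≤ N →
              FREM.traceNorm (ρ (n * τ) - S.numSol τ (ρ 0) n)
                ≤ FREM.C₃ (C₁ M) (S.C₂ T) T * τ ^ 2) := by
  obtain ⟨C₁, hC₁, h⟩ := theorem3p1_general m K
  exact ⟨C₁, hC₁, fun T hT S hS ρ _ => h T hT S hS ρ⟩
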